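/- Let $k\ge 1$ and $[k]=\{1,\dots,k\}$. A $[k]$-graphon is a symmetric measurable function $W$ from $[0,1]^2$ to the set of probability measures on $[k]$; write $W_i(x,y):=W(x,y)(\{i\})$ for $i\in[k]$. For $[k]$-graphons $U,W$ let $$d_{k\square}(U,W):=\sup_{S,T\subseteq[0,1]}\ \sum_{i=1}^k\left|\int_{S\times T}\bigl(U_i(x,y)-W_i(x,y)\bigr)\,dx\,dy\right|,$$ where the supremum is over all pairs of Lebesgue-measurable (equivalently, Borel) sets $S,T$, and let $$\delta_{k\square}(U,W):=\inf_{\varphi}\ d_{k\square}(U,W^\varphi),\qquad W^\varphi(x,y):=W(\varphi(x),\varphi(y)),$$ where the infimum is over all (not necessarily invertible) measure-preserving maps $\varphi:[0,1]\to[0,1]$. **Theorem.** Let $\mathcal W_k$ be the set of all $[k]$-graphons. The relation $\delta_{k\square}(U,W)=0$ is an equivalence relation on $\mathcal W_k$, $\delta_{k\square}$ induces a metric on the quotient $\widetilde{\mathcal W_k}$ of $\mathcal W_k$ by this relation, and the metric space $(\widetilde{\mathcal W_k},\delta_{k\square})$ is compact. -/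

import Mathlib

open MeasureTheory unitInterval

/-- A `[k]`-graphon: a symmetric measurable function from `[0,1]²` to the space of probability
measures on the finite set of `k` colours (with the σ-algebra generated by the evaluation maps,
which for a finite set of colours is the Borel σ-algebra). -/
structure DecoratedGraphon (k : ℕ) where
  toFun : I × I → ProbabilityMeasure (Fin k)
  measurable_toFun : Measurable fun z => (toFun z : Measure (Fin k))
  symm : ∀ x y : I, toFun (x, y) = toFun (y, x)

namespace DecoratedGraphon

variable {k : ℕ}

/-- `W.prob i (x, y)` is the probability of the colour `i` under the measure `W(x, y)`. -/
noncomputable def prob (W : DecoratedGraphon k) (i : Fin k) (z : I × I) : ℝ :=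
  (W.toFun z : Measure (Fin k)).real {i}

/-- The pull-back `W^φ(x, y) = W(φ(x), φ(y))` along a measure-preserving map `φ`
(which need not be invertible). -/
def pullback (W : DecoratedGraphon k) (φ : I → I) (hφ : MeasurePreserving φ volume volume) :
    DecoratedGraphon k where
  toFun z := W.toFun (φ z.1, φ z.2)
  measurable_toFun := W.measurable_toFun.comp
    ((hφ.measurable.comp measurable_fst).prodMk (hφ.measurable.comp measurable_snd))
  symm x y := W.symm (φ x) (φ y)

/-- The labelled cut distance: the supremum over measurable `S, T ⊆ [0,1]` of
`∑ i, |∫_{S × T} (U_i - W_i)|`. -/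
noncomputable def cutDist (U W : DecoratedGraphon k) : ℝ :=
  ⨆ p : {S : Set I // MeasurableSet S} × {T : Set I // MeasurableSet T},
    ∑ i : Fin k, |∫ z in (p.1 : Set I) ×ˢ (p.2 : Set I), (U.prob i z - W.prob i z)|

/-- The (unlabelled) cut distance: the infimum of the labelled cut distances between `U` and
`W^φ`, over all measure-preserving maps `φ : [0,1] → [0,1]`. -/
noncomputable def cutDelta (U W : DecoratedGraphon k) : ℝ :=
  ⨅ φ : {φ : I → I // MeasurePreserving φ volume volume}, cutDist U (W.pullback φ.1 φ.2)

/-- `U` and `W` are identified when their cut distance is zero. -/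
def CutEquiv (U W : DecoratedGraphon k) : Prop :=
  cutDelta U W = 0

end DecoratedGraphon

/-!
A measure-preserving `φ` of `[0, 1]` has approximate inverses `ψ` (measure-preserving, with `φ ∘ ψ`
close to the identity), which makes the cut distance symmetric and `W ↦ W^φ` invisible to it.
By weak regularity every graphon is close, in cut norm, to a step kernel with boundedly many steps
and coefficients from a finite set; rearranging the steps into intervals shows that graphons with
the same coefficients and nearly the same step sizes are close, so the space is totally bounded.
It is complete: in a fast Cauchy sequence each graphon can be rearranged in turn to be close to its
predecessor, and then a weak limit is a limit in cut norm, which is weakly lower semicontinuous.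
-/

open Filter Topology ProbabilityTheory
open scoped RealInnerProductSpace

section Atomless

lemma sum_restrict_preimage_singleton {α L : Type*} [MeasurableSpace α] [MeasurableSpace L]
    [Countable L] [MeasurableSingletonClass L] (μ : Measure α) {c : α → L} (hc : Measurable c) :
    Measure.sum (fun l => μ.restrict (c ⁻¹' {l})) = μ := by
  rw [← Measure.restrict_iUnion (fun l m hlm => ?_) fun l => hc (measurableSet_singleton l),
    ← Set.preimage_iUnion, Set.iUnion_of_singleton, Set.preimage_univ, Measure.restrict_univ]
  exact Disjoint.preimage c (Set.disjoint_singleton.2 hlm)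

lemma continuous_cdf (ν : Measure ℝ) [IsProbabilityMeasure ν] [NullSingletonClass ν] :
    Continuous (cdf ν) := by
  refine continuous_iff_continuousAt.2 fun x => ?_
  rw [(cdf ν).mono.continuousAt_iff_leftLim_eq_rightLim, StieltjesFunction.rightLim_eq]
  have hjump : ENNReal.ofReal (cdf ν x - Function.leftLim (cdf ν) x) = 0 := by
    rw [← StieltjesFunction.measure_singleton, measure_cdf, measure_singleton]
  exact le_antisymm ((cdf ν).mono.leftLim_le le_rfl)
    (sub_nonpos.1 (ENNReal.ofReal_eq_zero.1 hjump))

lemma measureReal_cdf_le (ν : Measure ℝ) [IsProbabilityMeasure ν] [NullSingletonClass ν] (t : I) :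
    ν.real {x | cdf ν x ≤ t} = t := by
  have hval : ∀ s : ℝ, 0 < s → s < 1 → ∃ x, cdf ν x = s := fun s h0 h1 =>
    mem_range_of_exists_le_of_exists_ge (continuous_cdf ν)
      ((tendsto_cdf_atBot ν).eventually_le_const h0).exists
      ((tendsto_cdf_atTop ν).eventually_const_le h1).exists
  refine le_antisymm (le_of_forall_gt_imp_ge_of_dense fun s hs => ?_)
    (le_of_forall_lt_imp_le_of_dense fun s hs => ?_)
  · rcases le_or_gt 1 s with h1 | h1
    · exact measureReal_le_one.trans h1
    obtain ⟨x, rfl⟩ := hval s (t.2.1.trans_lt hs) h1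
    rw [cdf_eq_real ν x]
    exact measureReal_mono fun y hy => ((monotone_cdf ν).reflect_lt (hy.trans_lt hs)).le
  · rcases le_or_gt s 0 with h0 | h0
    · exact h0.trans measureReal_nonneg
    obtain ⟨x, rfl⟩ := hval s h0 (hs.trans_le t.2.2)
    rw [cdf_eq_real ν x]
    exact measureReal_mono fun y hy => (monotone_cdf ν hy).trans hs.le

variable {α β L : Type*} [MeasurableSpace α] [StandardBorelSpace α] [MeasurableSpace β]

lemma exists_measurePreserving_unitInterval (μ : Measure α) [IsProbabilityMeasure μ]
    [NullSingletonClass μ] : ∃ h : α → I, MeasurePreserving h μ volume := by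
  have he : MeasurableEmbedding (embeddingReal α) := measurableEmbedding_embeddingReal α
  set ν : Measure ℝ := μ.map (embeddingReal α)
  have : IsProbabilityMeasure ν := Measure.isProbabilityMeasure_map he.measurable.aemeasurable
  have : NullSingletonClass ν := ⟨fun x => by
    rw [he.map_apply]
    exact (Set.subsingleton_singleton.preimage he.injective).measure_zero μ⟩
  let G : ℝ → I := fun x => ⟨cdf ν x, cdf_nonneg ν x, cdf_le_one ν x⟩
  have hG : Measurable G := ((continuous_cdf ν).subtype_mk _).measurable
  have hνG : ν.map G = volume := by
    have : IsProbabilityMeasure (ν.map G) := Measure.isProbabilityMeasure_map hG.aemeasurable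
    refine Measure.ext_of_Iic _ _ fun t => ?_
    rw [Measure.map_apply hG measurableSet_Iic, unitInterval.volume_Iic, ← measureReal_cdf_le ν t,
      ofReal_measureReal]
    rfl
  exact ⟨G ∘ embeddingReal α, hG.comp he.measurable,
    by rw [← Measure.map_map hG he.measurable, hνG]⟩

variable [StandardBorelSpace β]

lemma exists_measurePreserving_of_measure_univ_eq [Nonempty β] (μ : Measure α) [IsFiniteMeasure μ]
    [NullSingletonClass μ] (ν : Measure β) (h : μ Set.univ = ν Set.univ) :
    ∃ g : α → β, MeasurePreserving g μ ν := by
  rcases eq_or_ne (μ Set.univ) 0 with hμ0 | hμ0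
  · have hν0 : ν = 0 := Measure.measure_univ_eq_zero.1 (h ▸ hμ0)
    rw [Measure.measure_univ_eq_zero.1 hμ0, hν0]
    exact ⟨fun _ => Classical.arbitrary β, measurable_const, Measure.map_zero _⟩
  set m := μ Set.univ
  have hm : m ≠ ⊤ := measure_ne_top μ _
  have : IsProbabilityMeasure (m⁻¹ • μ) := ⟨ENNReal.inv_mul_cancel hμ0 hm⟩
  have : IsProbabilityMeasure (m⁻¹ • ν) := ⟨by
    rw [Measure.smul_apply, ← h]; exact ENNReal.inv_mul_cancel hμ0 hm⟩
  have : NullSingletonClass (m⁻¹ • μ) := ⟨fun x => by simp⟩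
  obtain ⟨u, hu⟩ := exists_measurePreserving_unitInterval (m⁻¹ • μ)
  obtain ⟨v, hv, hvν⟩ := (m⁻¹ • ν).exists_measurable_map_eq
  have hvu := (MeasurePreserving.comp ⟨hv, hvν⟩ hu).smul_measure m
  simp only [smul_smul, ENNReal.mul_inv_cancel hμ0 hm, one_smul] at hvu
  exact ⟨v ∘ u, hvu⟩

lemma exists_measurePreserving_comp_ae_eq [Nonempty β] [Countable L] [MeasurableSpace L]
    [MeasurableSingletonClass L] {μ : Measure α} [IsFiniteMeasure μ] [NullSingletonClass μ]
    {ν : Measure β} {c : α → L} {c' : β → L} (hc : Measurable c) (hc' : Measurable c')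
    (h : μ.map c = ν.map c') :
    ∃ φ : α → β, MeasurePreserving φ μ ν ∧ ∀ᵐ x ∂μ, c' (φ x) = c x := by
  have hm : ∀ l, MeasurableSet (c ⁻¹' {l}) := fun l => hc (measurableSet_singleton l)
  have hm' : ∀ l, MeasurableSet (c' ⁻¹' {l}) := fun l => hc' (measurableSet_singleton l)
  have hmass : ∀ l, μ.restrict (c ⁻¹' {l}) Set.univ = ν.restrict (c' ⁻¹' {l}) Set.univ :=
    fun l => by
      rw [Measure.restrict_apply_univ, Measure.restrict_apply_univ,
        ← Measure.map_apply hc (measurableSet_singleton l), h,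
        Measure.map_apply hc' (measurableSet_singleton l)]
  choose g hg using fun l =>
    exists_measurePreserving_of_measure_univ_eq (μ.restrict (c ⁻¹' {l})) _ (hmass l)
  let φ : α → β := fun x => g (c x) x
  have hφ : Measurable φ :=
    (measurable_from_prod_countable_right fun l => (hg l).measurable :
      Measurable fun p : L × α => g p.1 p.2).comp (hc.prodMk measurable_id)
  have hfiber : ∀ l, (μ.restrict (c ⁻¹' {l})).map φ = ν.restrict (c' ⁻¹' {l}) := fun l => by
    rw [← (hg l).map_eq]
    refine Measure.map_congr ?_
    filter_upwards [ae_restrict_mem (hm l)] with x (hx : c x = l)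
    simp only [φ, hx]
  refine ⟨φ, ⟨hφ, ?_⟩, ?_⟩
  · rw [← sum_restrict_preimage_singleton μ hc, Measure.map_sum hφ.aemeasurable]
    simp_rw [hfiber]
    exact sum_restrict_preimage_singleton ν hc'
  · rw [← sum_restrict_preimage_singleton μ hc, Measure.ae_sum_iff]
    intro l
    have hl : ∀ᵐ y ∂(μ.restrict (c ⁻¹' {l})).map φ, c' y = l := by
      rw [hfiber]
      exact ae_restrict_mem (hm' l)
    filter_upwards [ae_of_ae_map hφ.aemeasurable hl, ae_restrict_mem (hm l)] with x hx hcx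
    exact hx.trans hcx.symm

end Atomless

section ApproximateInverse

lemma exists_measurable_fin_dist_lt (α : Type*) [PseudoMetricSpace α] [CompactSpace α]
    [MeasurableSpace α] [OpensMeasurableSpace α] {δ : ℝ} (hδ : 0 < δ) :
    ∃ (n : ℕ) (c : α → Fin n), Measurable c ∧ ∀ x y, c x = c y → dist x y < δ := by
  rcases isEmpty_or_nonempty α with hα | hα
  · exact ⟨0, hα.elim, Subsingleton.measurable, fun x => hα.elim x⟩
  let e : ℕ → α := TopologicalSpace.denseSeq α
  obtain ⟨t, ht⟩ := isCompact_univ.elim_finite_subcover (fun i => Metric.ball (e i) (δ / 2))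
    (fun i => Metric.isOpen_ball) fun x _ => Set.mem_iUnion.2 <| by
      exact (TopologicalSpace.denseRange_denseSeq α).exists_dist_lt x (half_pos hδ)
  set N := t.sup id
  have hN : ∀ x, dist x (SimpleFunc.nearestPt e N x) < δ / 2 := fun x => by
    obtain ⟨i, hit, hi⟩ := Set.mem_iUnion₂.1 (ht (Set.mem_univ x))
    have hnear := SimpleFunc.edist_nearestPt_le e x (Finset.le_sup (f := id) hit)
    rw [edist_dist, edist_dist, ENNReal.ofReal_le_ofReal_iff dist_nonneg, dist_comm,
      dist_comm (e _)] at hnear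
    exact hnear.trans_lt hi
  refine ⟨N + 1, fun x => ⟨SimpleFunc.nearestPtInd e N x,
    Nat.lt_succ_of_le (SimpleFunc.nearestPtInd_le e N x)⟩, measurable_to_countable' fun i => ?_,
    fun x y hxy => ?_⟩
  · convert (SimpleFunc.nearestPtInd e N).measurableSet_fiber i using 1
    ext x
    simp [Fin.ext_iff]
  · have hxy' : SimpleFunc.nearestPt e N x = SimpleFunc.nearestPt e N y :=
      congrArg e (congrArg Fin.val hxy)
    linarith [dist_triangle_right x y (SimpleFunc.nearestPt e N x), hN x, hxy' ▸ hN y]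

lemma exists_measurePreserving_dist_comp_lt {α β : Type*} [MetricSpace α] [CompactSpace α]
    [MeasurableSpace α] [BorelSpace α] [MeasurableSpace β] [StandardBorelSpace β] [Nonempty β]
    {μ : Measure α} [IsFiniteMeasure μ] [NullSingletonClass μ] {ν : Measure β} {φ : β → α}
    (hφ : MeasurePreserving φ ν μ) {δ : ℝ} (hδ : 0 < δ) :
    ∃ ψ : α → β, MeasurePreserving ψ μ ν ∧ ∀ᵐ x ∂μ, dist (φ (ψ x)) x < δ := by
  obtain ⟨n, c, hc, hcδ⟩ := exists_measurable_fin_dist_lt α hδ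
  obtain ⟨ψ, hψ, hψc⟩ := exists_measurePreserving_comp_ae_eq hc (hc.comp hφ.measurable)
    (by rw [← Measure.map_map hc hφ.measurable, hφ.map_eq])
  exact ⟨ψ, hψ, hψc.mono fun x hx => hcδ _ _ hx⟩

lemma integral_norm_sub_comp_le {γ E : Type*} [MeasurableSpace γ] [NormedAddCommGroup E]
    {μ : Measure γ} {θ : γ → γ} (hθ : MeasurePreserving θ μ μ) {f g : γ → E}
    (hf : Integrable f μ) (hg : Integrable g μ) :
    ∫ z, ‖f z - f (θ z)‖ ∂μ ≤ 2 * ∫ z, ‖f z - g z‖ ∂μ + ∫ z, ‖g (θ z) - g z‖ ∂μ := by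
  have hfg : Integrable (fun z => ‖f z - g z‖) μ := (hf.sub hg).norm
  have hgg : Integrable (fun z => ‖g (θ z) - g z‖) μ :=
    ((hθ.integrable_comp_of_integrable hg).sub hg).norm
  have hfgθ : Integrable (fun z => ‖f (θ z) - g (θ z)‖) μ := hθ.integrable_comp_of_integrable hfg
  have hsum : Integrable (fun z => ‖f z - g z‖ + ‖g (θ z) - g z‖) μ := hfg.add hgg
  have hinv : ∫ z, ‖f (θ z) - g (θ z)‖ ∂μ = ∫ z, ‖f z - g z‖ ∂μ := by
    rw [← hθ.map_eq] at hfg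
    rw [← integral_map hθ.aemeasurable hfg.aestronglyMeasurable, hθ.map_eq]
  calc ∫ z, ‖f z - f (θ z)‖ ∂μ
      ≤ ∫ z, (‖f z - g z‖ + ‖g (θ z) - g z‖ + ‖f (θ z) - g (θ z)‖) ∂μ := by
        refine integral_mono (hf.sub (hθ.integrable_comp_of_integrable hf)).norm
          (hsum.add hfgθ) fun z => ?_
        have htriangle := dist_triangle4 (f z) (g z) (g (θ z)) (f (θ z))
        rw [dist_comm (g z), dist_comm (g (θ z)) (f (θ z))] at htriangle
        simpa only [dist_eq_norm] using htriangle
    _ = 2 * ∫ z, ‖f z - g z‖ ∂μ + ∫ z, ‖g (θ z) - g z‖ ∂μ := by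
        rw [integral_add hsum hfgθ, integral_add hfg hgg, hinv]
        ring

lemma exists_pos_forall_integral_norm_sub_comp_le {γ E : Type*} [PseudoMetricSpace γ]
    [CompactSpace γ] [MeasurableSpace γ] [BorelSpace γ] [NormedAddCommGroup E] [NormedSpace ℝ E]
    {μ : Measure γ} [IsFiniteMeasure μ] {f : γ → E} (hf : Integrable f μ) {ε : ℝ} (hε : 0 < ε) :
    ∃ δ > 0, ∀ θ : γ → γ, MeasurePreserving θ μ μ → (∀ᵐ z ∂μ, dist (θ z) z < δ) →
      ∫ z, ‖f z - f (θ z)‖ ∂μ ≤ ε := by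
  obtain ⟨g, hfg, hg⟩ := hf.exists_boundedContinuous_integral_sub_le (show 0 < ε / 3 by positivity)
  set m := μ.real Set.univ
  obtain ⟨δ, hδ, hgδ⟩ := Metric.uniformContinuous_iff.1
    (CompactSpace.uniformContinuous_of_continuous g.continuous) (ε / 3 / (m + 1)) (by positivity)
  refine ⟨δ, hδ, fun θ hθ hθδ => ?_⟩
  have hgg : ∫ z, ‖g (θ z) - g z‖ ∂μ ≤ ε / 3 := by
    calc ∫ z, ‖g (θ z) - g z‖ ∂μ ≤ ∫ _, ε / 3 / (m + 1) ∂μ := by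
          refine integral_mono_ae ((hθ.integrable_comp_of_integrable hg).sub hg).norm
            (integrable_const _) (hθδ.mono fun z hz => ?_)
          simpa only [dist_eq_norm] using (hgδ hz).le
      _ = m / (m + 1) * (ε / 3) := by rw [integral_const, smul_eq_mul]; ring
      _ ≤ ε / 3 := mul_le_of_le_one_left (by positivity)
          (div_le_one_of_le₀ (by linarith) (by positivity))
  linarith [integral_norm_sub_comp_le hθ hf hg]

end ApproximateInverse

section CutNorm

variable {α β E : Type*} [MeasurableSpace α] [MeasurableSpace β] {μ : Measure α} {ν : Measure β}
  [NormedAddCommGroup E] [NormedSpace ℝ E] {F G : α × β → E}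

/-- The cut norm of a vector-valued kernel `F`: the supremum of `‖∫ F‖` over measurable rectangles.
It bounds those integrals only when `F` is integrable. -/
noncomputable def cutNorm (μ : Measure α) (ν : Measure β) (F : α × β → E) : ℝ :=
  ⨆ p : {S : Set α // MeasurableSet S} × {T : Set β // MeasurableSet T},
    ‖∫ z in (p.1 : Set α) ×ˢ (p.2 : Set β), F z ∂(μ.prod ν)‖

lemma norm_setIntegral_le_integral_norm {γ : Type*} [MeasurableSpace γ] {ρ : Measure γ} {F : γ → E}
    (hF : Integrable F ρ) (s : Set γ) : ‖∫ z in s, F z ∂ρ‖ ≤ ∫ z, ‖F z‖ ∂ρ :=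
  (norm_integral_le_integral_norm F).trans
    (setIntegral_le_integral hF.norm (ae_of_all _ fun _ => norm_nonneg _))

lemma cutNorm_le {C : ℝ} (h : ∀ S T, MeasurableSet S → MeasurableSet T →
    ‖∫ z in S ×ˢ T, F z ∂(μ.prod ν)‖ ≤ C) : cutNorm μ ν F ≤ C :=
  have : Nonempty ({S : Set α // MeasurableSet S} × {T : Set β // MeasurableSet T}) :=
    ⟨⟨∅, .empty⟩, ⟨∅, .empty⟩⟩
  ciSup_le fun p => h p.1 p.2 p.1.2 p.2.2

lemma cutNorm_nonneg : 0 ≤ cutNorm μ ν F := Real.iSup_nonneg fun _ => norm_nonneg _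

lemma cutNorm_neg : cutNorm μ ν (-F) = cutNorm μ ν F := by
  simp only [cutNorm, Pi.neg_apply, integral_neg, norm_neg]

lemma cutNorm_sub_comm : cutNorm μ ν (F - G) = cutNorm μ ν (G - F) := by
  rw [← cutNorm_neg, neg_sub]

lemma norm_setIntegral_le_cutNorm (hF : Integrable F (μ.prod ν)) {S : Set α} {T : Set β}
    (hS : MeasurableSet S) (hT : MeasurableSet T) :
    ‖∫ z in S ×ˢ T, F z ∂(μ.prod ν)‖ ≤ cutNorm μ ν F :=
  le_ciSup (f := fun p : {S : Set α // MeasurableSet S} × {T : Set β // MeasurableSet T} =>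
      ‖∫ z in (p.1 : Set α) ×ˢ (p.2 : Set β), F z ∂(μ.prod ν)‖)
    ⟨∫ z, ‖F z‖ ∂(μ.prod ν), Set.forall_mem_range.2 fun _ => norm_setIntegral_le_integral_norm hF _⟩
    ⟨⟨S, hS⟩, ⟨T, hT⟩⟩

lemma cutNorm_le_integral_norm (hF : Integrable F (μ.prod ν)) :
    cutNorm μ ν F ≤ ∫ z, ‖F z‖ ∂(μ.prod ν) :=
  cutNorm_le fun _ _ _ _ => norm_setIntegral_le_integral_norm hF _

lemma cutNorm_add_le (hF : Integrable F (μ.prod ν)) (hG : Integrable G (μ.prod ν)) :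
    cutNorm μ ν (F + G) ≤ cutNorm μ ν F + cutNorm μ ν G :=
  cutNorm_le fun S T hS hT => by
    simp only [Pi.add_apply, integral_add hF.integrableOn hG.integrableOn]
    exact (norm_add_le _ _).trans
      (add_le_add (norm_setIntegral_le_cutNorm hF hS hT) (norm_setIntegral_le_cutNorm hG hS hT))

lemma cutNorm_sub_le_add {H : α × β → E} (hF : Integrable F (μ.prod ν))
    (hG : Integrable G (μ.prod ν)) (hH : Integrable H (μ.prod ν)) :
    cutNorm μ ν (F - H) ≤ cutNorm μ ν (F - G) + cutNorm μ ν (G - H) := by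
  rw [← sub_add_sub_cancel F G H]
  exact cutNorm_add_le (hF.sub hG) (hG.sub hH)

lemma cutNorm_piLp_one_le_sum {ι : Type*} [Fintype ι] {F : α × β → PiLp 1 fun _ : ι => ℝ}
    (hF : ∀ i, Integrable (fun z => F z i) (μ.prod ν)) :
    cutNorm μ ν F ≤ ∑ i, cutNorm μ ν fun z => F z i :=
  cutNorm_le fun S T hS hT => by
    rw [PiLp.norm_eq_of_L1]
    refine Finset.sum_le_sum fun i _ => ?_
    rw [eval_integral_piLp fun i => (hF i).integrableOn]
    exact norm_setIntegral_le_cutNorm (hF i) hS hT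

lemma cutNorm_sub_le_of_tendsto {ι : Type*} {u : Filter ι} [u.NeBot] {G : ι → α × β → E}
    {H : α × β → E} (hF : Integrable F (μ.prod ν)) (hG : ∀ n, Integrable (G n) (μ.prod ν))
    (hH : Integrable H (μ.prod ν))
    (hlim : ∀ S T, MeasurableSet S → MeasurableSet T →
      Tendsto (fun n => ∫ z in S ×ˢ T, G n z ∂(μ.prod ν)) u (𝓝 (∫ z in S ×ˢ T, H z ∂(μ.prod ν))))
    {a : ℝ} (ha : ∀ᶠ n in u, cutNorm μ ν (F - G n) ≤ a) : cutNorm μ ν (F - H) ≤ a :=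
  cutNorm_le fun S T hS hT => by
    refine le_of_tendsto (x := u) (f := fun n => ‖∫ z in S ×ˢ T, (F - G n) z ∂(μ.prod ν)‖) ?_
      (ha.mono fun n hn => (norm_setIntegral_le_cutNorm (hF.sub (hG n)) hS hT).trans hn)
    simp only [Pi.sub_apply, integral_sub hF.integrableOn (hG _).integrableOn,
      integral_sub hF.integrableOn hH.integrableOn]
    exact (tendsto_const_nhds.sub (hlim S T hS hT)).norm

/-- The best set is where the integrand is nonnegative. -/
lemma exists_integral_le_setIntegral_of_le {ρ : Measure α} {g : α → ℝ} (hρ : ρ ≤ μ)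
    (hg : Integrable g μ) :
    ∃ S, MeasurableSet S ∧ ∫ x, g x ∂ρ ≤ ∫ x in S, g x ∂μ := by
  have hgm : StronglyMeasurable (hg.1.mk g) := hg.1.stronglyMeasurable_mk
  have hS : MeasurableSet {x | 0 ≤ hg.1.mk g x} :=
    measurableSet_le measurable_const hgm.measurable
  refine ⟨_, hS, ?_⟩
  calc ∫ x, g x ∂ρ ≤ ∫ x in {x | 0 ≤ hg.1.mk g x}, g x ∂ρ := by
        rw [← integral_indicator hS]
        refine integral_mono_ae (hg.mono_measure hρ) ((hg.mono_measure hρ).indicator hS) ?_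
        filter_upwards [ae_mono hρ hg.1.ae_eq_mk] with x hx
        by_cases h : 0 ≤ hg.1.mk g x
        · exact (Set.indicator_of_mem (s := {x | 0 ≤ hg.1.mk g x}) h g).ge
        · rw [Set.indicator_of_notMem (s := {x | 0 ≤ hg.1.mk g x}) h]
          exact hx.trans_le (not_le.1 h).le
    _ ≤ ∫ x in {x | 0 ≤ hg.1.mk g x}, g x ∂μ := by
        refine integral_mono_measure (Measure.restrict_mono le_rfl hρ) ?_ hg.integrableOn
        filter_upwards [ae_restrict_mem hS, ae_restrict_of_ae hg.1.ae_eq_mk] with x hx hgx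
        exact hgx.ge.trans' hx

lemma exists_integral_prod_le_setIntegral_of_le [IsFiniteMeasure μ] [IsFiniteMeasure ν]
    {ρ : Measure α} {τ : Measure β} (hρ : ρ ≤ μ) (hτ : τ ≤ ν) {g : α × β → ℝ}
    (hg : Integrable g (μ.prod ν)) :
    ∃ S T, MeasurableSet S ∧ MeasurableSet T ∧
      ∫ z, g z ∂(ρ.prod τ) ≤ ∫ z in S ×ˢ T, g z ∂(μ.prod ν) := by
  have : IsFiniteMeasure ρ := isFiniteMeasure_of_le μ hρ
  have : IsFiniteMeasure τ := isFiniteMeasure_of_le ν hτ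
  have hgτ : Integrable g (μ.prod τ) := hg.mono_measure (Measure.prod_mono le_rfl hτ)
  obtain ⟨S, hS, hgS⟩ := exists_integral_le_setIntegral_of_le hρ hgτ.integral_prod_left
  have hgS' : Integrable g ((μ.restrict S).prod ν) :=
    hg.mono_measure (Measure.prod_mono Measure.restrict_le_self le_rfl)
  obtain ⟨T, hT, hgT⟩ := exists_integral_le_setIntegral_of_le hτ hgS'.integral_prod_right
  refine ⟨S, T, hS, hT, ?_⟩
  calc ∫ z, g z ∂(ρ.prod τ) = ∫ x, ∫ y, g (x, y) ∂τ ∂ρ :=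
        integral_prod _ (hgτ.mono_measure (Measure.prod_mono hρ le_rfl))
    _ ≤ ∫ x in S, ∫ y, g (x, y) ∂τ ∂μ := hgS
    _ = ∫ y, ∫ x in S, g (x, y) ∂μ ∂τ :=
        integral_integral_swap (hgS'.mono_measure (Measure.prod_mono le_rfl hτ))
    _ ≤ ∫ y in T, ∫ x in S, g (x, y) ∂μ ∂ν := hgT
    _ = ∫ z in S ×ˢ T, g z ∂(μ.prod ν) := by
        rw [← Measure.prod_restrict, integral_prod_symm]
        exact hgS'.mono_measure (Measure.prod_mono le_rfl Measure.restrict_le_self)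

variable {α' β' : Type*} [MeasurableSpace α'] [MeasurableSpace β'] {μ' : Measure α'}
  {ν' : Measure β'} {φ : α' → α} {ψ : β' → β}

lemma map_restrict_le (hφ : MeasurePreserving φ μ' μ) (S : Set α') :
    (μ'.restrict S).map φ ≤ μ :=
  hφ.map_eq ▸ Measure.map_mono Measure.restrict_le_self hφ.measurable

/-- A functional norming `∫_{S × T} F ∘ (φ × ψ)` reduces this to real kernels; there, pushing
`S × T` forward gives a product of densities bounded by one, and the extremal ones are
indicators. -/
lemma cutNorm_comp_prodMap_le [CompleteSpace E] [IsFiniteMeasure μ] [IsFiniteMeasure ν]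
    [SFinite μ'] [SFinite ν'] (hφ : MeasurePreserving φ μ' μ)
    (hψ : MeasurePreserving ψ ν' ν) (hF : Integrable F (μ.prod ν)) :
    cutNorm μ' ν' (F ∘ Prod.map φ ψ) ≤ cutNorm μ ν F :=
  cutNorm_le fun S T _ _ => by
    set ρ := (μ'.restrict S).map φ
    set τ := (ν'.restrict T).map ψ
    have hρ : ρ ≤ μ := map_restrict_le hφ S
    have hτ : τ ≤ ν := map_restrict_le hψ T
    have hFρτ : Integrable F (ρ.prod τ) := hF.mono_measure (Measure.prod_mono hρ hτ)
    obtain ⟨g, hg, hgF⟩ := exists_dual_vector'' ℝ (∫ z, F z ∂(ρ.prod τ))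
    obtain ⟨S', T', hS', hT', hle⟩ :=
      exists_integral_prod_le_setIntegral_of_le hρ hτ (g.integrable_comp hF)
    have hpush : ∫ z in S ×ˢ T, (F ∘ Prod.map φ ψ) z ∂(μ'.prod ν') = ∫ z, F z ∂(ρ.prod τ) := by
      have hmap : ρ.prod τ = ((μ'.restrict S).prod (ν'.restrict T)).map (Prod.map φ ψ) :=
        Measure.map_prod_map _ _ hφ.measurable hψ.measurable
      rw [hmap] at hFρτ ⊢
      rw [integral_map (hφ.measurable.prodMap hψ.measurable).aemeasurable
        hFρτ.aestronglyMeasurable, Measure.prod_restrict]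
      rfl
    calc ‖∫ z in S ×ˢ T, (F ∘ Prod.map φ ψ) z ∂(μ'.prod ν')‖
        = ‖∫ z, F z ∂(ρ.prod τ)‖ := by rw [hpush]
      _ = ∫ z, g (F z) ∂(ρ.prod τ) := by rw [g.integral_comp_comm hFρτ, hgF]; rfl
      _ ≤ ∫ z in S' ×ˢ T', g (F z) ∂(μ.prod ν) := hle
      _ = g (∫ z in S' ×ˢ T', F z ∂(μ.prod ν)) := g.integral_comp_comm hF.integrableOn
      _ ≤ 1 * cutNorm μ ν F := (le_abs_self _).trans (g.le_of_opNorm_le_of_le hg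
          (norm_setIntegral_le_cutNorm hF hS' hT'))
      _ = cutNorm μ ν F := one_mul _

end CutNorm

section StepKernel

variable {α L E : Type*} [MeasurableSpace α] {μ : Measure α} [NormedAddCommGroup E]
  {A : L → L → E}

/-- The kernel that takes the value `A l m` on the rectangle `{c = l} × {c = m}`. -/
def stepKernel (A : L → L → E) (c : α → L) (z : α × α) : E := A (c z.1) (c z.2)

variable [Finite L] [MeasurableSpace L] [DiscreteMeasurableSpace L] {c c' : α → L}

lemma integrable_stepKernel [IsFiniteMeasure μ] (A : L → L → E) (hc : Measurable c) :
    Integrable (stepKernel A c) (μ.prod μ) := by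
  have hA : Integrable (Function.uncurry A) ((μ.prod μ).map (Prod.map c c)) :=
    .of_finite
  exact hA.comp_measurable (hc.prodMap hc)

variable [NormedSpace ℝ E]

/-- The kernels differ only where one of the two coordinates lies in `{c ≠ c'}`. -/
lemma cutNorm_stepKernel_sub_le [IsProbabilityMeasure μ] (hc : Measurable c) (hc' : Measurable c')
    {C : ℝ} (hA : ∀ l m, ‖A l m‖ ≤ C) :
    cutNorm μ μ (stepKernel A c - stepKernel A c') ≤ 4 * C * μ.real {x | c x ≠ c' x} := by
  set D := {x | c x ≠ c' x}
  have hD : MeasurableSet D := (measurableSet_eq_fun hc hc').compl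
  set d : α → ℝ := D.indicator fun _ => 2 * C
  have hd : Integrable d μ := (integrable_const _).indicator hD
  have hdint : ∫ x, d x ∂μ = 2 * C * μ.real D := by
    rw [integral_indicator_const _ hD, smul_eq_mul, mul_comm]
  have hC : ∀ x, 0 ≤ d x := fun x => Set.indicator_nonneg (fun y _ => by
    linarith [(norm_nonneg _).trans (hA (c y) (c y))]) x
  have hint := (integrable_stepKernel (μ := μ) A hc).sub (integrable_stepKernel A hc')
  refine (cutNorm_le_integral_norm hint).trans ?_
  calc ∫ z, ‖(stepKernel A c - stepKernel A c') z‖ ∂(μ.prod μ)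
      ≤ ∫ z, (d z.1 + d z.2) ∂(μ.prod μ) := by
        refine integral_mono hint.norm (hd.comp_fst μ |>.add (hd.comp_snd μ)) fun z => ?_
        rcases eq_or_ne (c z.1) (c' z.1) with h1 | h1
        · rcases eq_or_ne (c z.2) (c' z.2) with h2 | h2
          · simpa [stepKernel, h1, h2] using add_nonneg (hC z.1) (hC z.2)
          · have : d z.2 = 2 * C := Set.indicator_of_mem h2 _
            have := norm_sub_le_of_le (hA (c z.1) (c z.2)) (hA (c' z.1) (c' z.2))
            simp only [Pi.sub_apply, stepKernel]
            linarith [hC z.1]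
        · have : d z.1 = 2 * C := Set.indicator_of_mem h1 _
          have := norm_sub_le_of_le (hA (c z.1) (c z.2)) (hA (c' z.1) (c' z.2))
          simp only [Pi.sub_apply, stepKernel]
          linarith [hC z.2]
    _ = 4 * C * μ.real D := by
        rw [integral_add (hd.comp_fst μ) (hd.comp_snd μ), integral_fun_fst, integral_fun_snd]
        simp only [probReal_univ, one_smul, hdint]
        ring

end StepKernel

section WeakRegularity

/-- As long as some `r ∈ R` has `ε < |⟪x, r⟫|`, subtracting `±ε • r` from `x` lowers `‖x‖ ^ 2` by
more than `ε ^ 2`. -/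
lemma exists_forall_abs_inner_sub_sum_le {H : Type*} [NormedAddCommGroup H] [InnerProductSpace ℝ H]
    {R : Set H} (hR : R.Nonempty) (hR1 : ∀ r ∈ R, ‖r‖ ≤ 1) {ε : ℝ} (hε : 0 < ε) (M : ℕ) (x : H)
    (hx : ‖x‖ ^ 2 < M * ε ^ 2) :
    ∃ (s : Fin M → SignType) (r : Fin M → H), (∀ j, r j ∈ R) ∧
      ∀ r' ∈ R, |⟪r', x - ∑ j, (ε * s j) • r j⟫| ≤ ε := by
  induction M generalizing x with
  | zero =>
    rw [Nat.cast_zero, zero_mul] at hx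
    exact absurd hx (sq_nonneg _).not_gt
  | succ M ih =>
    by_cases hsmall : ∀ r ∈ R, |⟪r, x⟫| ≤ ε
    · obtain ⟨r, hr⟩ := hR
      exact ⟨0, fun _ => r, fun _ => hr, by simpa using hsmall⟩
    push Not at hsmall
    obtain ⟨r, hr, hrx⟩ := hsmall
    set t : SignType := SignType.sign ⟪r, x⟫
    have htr : (t : ℝ) * ⟪r, x⟫ = |⟪r, x⟫| := sign_mul_self _
    have hnorm : ‖(ε * t) • r‖ ≤ ε := by
      have ht : ‖(t : ℝ)‖ ≤ 1 := by rcases t <;> simp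
      rw [norm_smul, norm_mul, Real.norm_of_nonneg hε.le, mul_assoc]
      exact mul_le_of_le_one_right hε.le (mul_le_one₀ ht (norm_nonneg r) (hR1 r hr))
    have henergy : ‖x - (ε * t) • r‖ ^ 2 < M * ε ^ 2 := by
      rw [norm_sub_sq_real, inner_smul_right, real_inner_comm, mul_assoc, htr]
      push_cast at hx
      nlinarith [pow_le_pow_left₀ (norm_nonneg _) hnorm 2, mul_lt_mul_of_pos_left hrx hε]
    obtain ⟨s, q, hq, hqx⟩ := ih _ henergy
    refine ⟨Fin.cons t s, Fin.cons r q, Fin.cases hr hq, ?_⟩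
    simpa [Fin.sum_univ_succ, sub_sub] using hqx

variable {α β : Type*} [MeasurableSpace α] [MeasurableSpace β]

lemma exists_cutNorm_sub_sum_indicator_le {μ : Measure α} {ν : Measure β} [IsProbabilityMeasure μ]
    [IsProbabilityMeasure ν] {f : α × β → ℝ} (hf : MemLp f 2 (μ.prod ν)) {ε : ℝ} (hε : 0 < ε)
    {M : ℕ} (hM : ∫ z, f z ^ 2 ∂(μ.prod ν) < M * ε ^ 2) :
    ∃ (s : Fin M → SignType) (S : Fin M → Set α) (T : Fin M → Set β),
      (∀ j, MeasurableSet (S j)) ∧ (∀ j, MeasurableSet (T j)) ∧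
      cutNorm μ ν (fun z => f z - ∑ j, ε * s j * (S j ×ˢ T j).indicator 1 z) ≤ ε := by
  let rect (S : Set α) (T : Set β) (hS : MeasurableSet S) (hT : MeasurableSet T) :
    Lp ℝ 2 (μ.prod ν) := indicatorConstLp 2 (hS.prod hT) (measure_ne_top _ _) 1
  have hrect1 : ∀ S T hS hT, ‖rect S T hS hT‖ ≤ 1 := fun S T hS hT =>
    norm_indicatorConstLp_le.trans <| by
      rw [norm_one, one_mul]
      exact Real.rpow_le_one measureReal_nonneg measureReal_le_one (by positivity)
  have hnorm : ‖hf.toLp f‖ ^ 2 < M * ε ^ 2 := by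
    refine lt_of_eq_of_lt ?_ hM
    rw [← real_inner_self_eq_norm_sq, L2.inner_def]
    refine integral_congr_ae (hf.coeFn_toLp.mono fun z hz => ?_)
    simp only [hz, real_inner_self_eq_norm_sq, Real.norm_eq_abs, sq_abs]
  obtain ⟨s, r, hr, hfr⟩ := exists_forall_abs_inner_sub_sum_le
    (R := {r | ∃ S T hS hT, r = rect S T hS hT}) ⟨_, ∅, ∅, .empty, .empty, rfl⟩
    (by rintro _ ⟨S, T, hS, hT, rfl⟩; exact hrect1 S T hS hT) hε M _ hnorm
  choose S T hS hT hrST using hr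
  refine ⟨s, S, T, hS, hT, cutNorm_le fun A B hA hB => ?_⟩
  convert hfr _ ⟨A, B, hA, hB, rfl⟩ using 1
  have hind : ∀ j, Integrable ((S j ×ˢ T j).indicator (1 : α × β → ℝ)) (μ.prod ν) := fun j =>
    (integrable_const (1 : ℝ)).indicator ((hS j).prod (hT j))
  have hfint : Integrable f (μ.prod ν) := hf.integrable one_le_two
  rw [integral_sub hfint.integrableOn
      (integrable_finsetSum _ fun j _ => ((hind j).const_mul _).integrableOn),
    integral_finsetSum _ fun j _ => ((hind j).const_mul _).integrableOn, inner_sub_right, inner_sum,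
    L2.inner_indicatorConstLp_one, Real.norm_eq_abs]
  congr 2
  · exact integral_congr_ae (ae_restrict_of_ae hf.coeFn_toLp.symm)
  · refine Finset.sum_congr rfl fun j _ => ?_
    rw [integral_const_mul, inner_smul_right, hrST, L2.inner_indicatorConstLp_one]
    congr 1
    exact integral_congr_ae (ae_restrict_of_ae indicatorConstLp_coeFn.symm)

/-- A step consists of the points with the same membership pattern in the sides of the rectangles
that approximate the coordinates of `F`. -/
lemma exists_finite_forall_cutNorm_sub_stepKernel_le (ι : Type*) [Fintype ι] (μ : Measure α)
    [IsProbabilityMeasure μ] {ε : ℝ} (hε : 0 < ε) :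
    ∃ (n : ℕ) (𝒜 : Set (Fin n → Fin n → PiLp 1 fun _ : ι => ℝ)), 𝒜.Finite ∧
      ∀ F : α × α → PiLp 1 fun _ : ι => ℝ, (∀ i, MemLp (fun z => F z i) 2 (μ.prod μ)) →
        (∀ i, ∫ z, F z i ^ 2 ∂(μ.prod μ) ≤ 1) →
        ∃ A ∈ 𝒜, ∃ c : α → Fin n, Measurable c ∧ cutNorm μ μ (F - stepKernel A c) ≤ ε := by
  classical
  set η := ε / (Fintype.card ι + 1)
  have hη : 0 < η := by positivity
  obtain ⟨M, hM⟩ := exists_nat_gt (1 / η ^ 2)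
  rw [div_lt_iff₀ (by positivity)] at hM
  let e := Fintype.equivFin (ι → Fin M → Prop × Prop)
  let A (s : ι → Fin M → SignType) : Fin _ → Fin _ → PiLp 1 fun _ : ι => ℝ := fun l m =>
    WithLp.toLp 1 fun i => ∑ j, η * s i j * if (e.symm l i j).1 ∧ (e.symm m i j).2 then 1 else 0
  refine ⟨_, Set.range A, Set.finite_range A, fun F hF hF1 => ?_⟩
  choose s S T hS hT hST using fun i =>
    exists_cutNorm_sub_sum_indicator_le (hF i) hη ((hF1 i).trans_lt hM)
  let c : α → ι → Fin M → Prop × Prop := fun x i j => (x ∈ S i j, x ∈ T i j)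
  have hc : Measurable c := measurable_pi_lambda _ fun i => measurable_pi_lambda _ fun j =>
    (measurable_mem.2 (hS i j)).prodMk (measurable_mem.2 (hT i j))
  have hec : Measurable (e ∘ c) := (measurable_of_countable e).comp hc
  have hcoord : ∀ z i, stepKernel (A s) (e ∘ c) z i =
      ∑ j, η * s i j * (S i j ×ˢ T i j).indicator 1 z := fun z i => by
    simp [stepKernel, A, c, Set.indicator_apply, Set.mem_prod]
  refine ⟨_, ⟨s, rfl⟩, e ∘ c, hec, ?_⟩
  calc cutNorm μ μ (F - stepKernel (A s) (e ∘ c))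
      ≤ ∑ i, cutNorm μ μ fun z => (F - stepKernel (A s) (e ∘ c)) z i :=
        cutNorm_piLp_one_le_sum fun i => ((hF i).integrable one_le_two).sub
          ((integrable_stepKernel (A s) hec).eval_piLp i)
    _ ≤ ∑ _i : ι, η := by
        refine Finset.sum_le_sum fun i _ => ?_
        simpa only [Pi.sub_apply, PiLp.sub_apply, hcoord] using hST i
    _ = Fintype.card ι / (Fintype.card ι + 1) * ε := by
        rw [Finset.sum_const, Finset.card_univ, nsmul_eq_mul]; ring
    _ ≤ ε := mul_le_of_le_one_left hε.le (div_le_one_of_le₀ (by linarith) (by positivity))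

end WeakRegularity

section Quantile

variable {Ω : Type*} [MeasurableSpace Ω] {n : ℕ}

/-- The cumulative masses of a labelling `c`, with strict inequality: `μ (c < j)`. -/
noncomputable def cumulativeMass (μ : Measure Ω) [IsProbabilityMeasure μ] (c : Ω → Fin n)
    (j : Fin n) : I :=
  ⟨μ.real {x | c x < j}, measureReal_nonneg, measureReal_le_one⟩

lemma monotone_cumulativeMass (μ : Measure Ω) [IsProbabilityMeasure μ] (c : Ω → Fin n) :
    Monotone (cumulativeMass μ c) := fun _ _ hij =>
  Subtype.coe_le_coe.1 (measureReal_mono fun _ hx => lt_of_lt_of_le hx hij)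

variable [NeZero n]

/-- The increasing labelling of `[0, 1]` whose cumulative masses are `F`: the label of `x` is the
largest `j` with `F j ≤ x`. -/
noncomputable def quantileLabel (F : Fin n → I) (x : I) : Fin n :=
  (Finset.univ.filter fun j => F j ≤ x).sup id

lemma cumulativeMass_zero (μ : Measure Ω) [IsProbabilityMeasure μ] (c : Ω → Fin n) :
    cumulativeMass μ c 0 = 0 :=
  Subtype.ext (by simp [cumulativeMass])

lemma le_quantileLabel_iff {F : Fin n → I} (hF : Monotone F) (hF0 : F 0 = 0) {j : Fin n} {x : I} :
    j ≤ quantileLabel F x ↔ F j ≤ x := by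
  refine ⟨fun h => ?_, fun h => Finset.le_sup (f := id) (by simpa using h)⟩
  obtain ⟨m, hm, hsup⟩ := Finset.exists_mem_eq_sup (Finset.univ.filter fun j => F j ≤ x)
    ⟨0, by simp [hF0]⟩ id
  exact (hF (h.trans_eq hsup)).trans (Finset.mem_filter.1 hm).2

lemma quantileLabel_preimage_Ici {F : Fin n → I} (hF : Monotone F) (hF0 : F 0 = 0) (j : Fin n) :
    quantileLabel F ⁻¹' Set.Ici j = Set.Ici (F j) :=
  Set.ext fun _ => le_quantileLabel_iff hF hF0

lemma measurable_quantileLabel {F : Fin n → I} (hF : Monotone F) (hF0 : F 0 = 0) :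
    Measurable (quantileLabel F) :=
  measurable_of_Ici fun j => quantileLabel_preimage_Ici hF hF0 j ▸ measurableSet_Ici

lemma map_quantileLabel_cumulativeMass (μ : Measure Ω) [IsProbabilityMeasure μ] {c : Ω → Fin n}
    (hc : Measurable c) :
    (volume : Measure I).map (quantileLabel (cumulativeMass μ c)) = μ.map c := by
  have hF := monotone_cumulativeMass μ c
  have hF0 := cumulativeMass_zero μ c
  have hq := measurable_quantileLabel hF hF0
  have : IsProbabilityMeasure ((volume : Measure I).map (quantileLabel (cumulativeMass μ c))) :=
    Measure.isProbabilityMeasure_map hq.aemeasurable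
  refine Measure.ext_of_Ici _ _ fun j => ?_
  have hm : MeasurableSet {x | c x < j} := hc measurableSet_Iio
  have hcompl : c ⁻¹' Set.Ici j = {x | c x < j}ᶜ := by ext x; simp
  rw [Measure.map_apply hq measurableSet_Ici, Measure.map_apply hc measurableSet_Ici,
    quantileLabel_preimage_Ici hF hF0, unitInterval.volume_Ici, hcompl, ← ofReal_measureReal,
    probReal_compl_eq_one_sub hm]
  rfl

variable [StandardBorelSpace Ω]

/-- Rearrange both labellings into increasing ones. -/
lemma exists_measurePreserving_measureReal_ne_le {μ : Measure Ω} [IsProbabilityMeasure μ]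
    {c c' : Ω → Fin n} (hc : Measurable c) (hc' : Measurable c') :
    ∃ ψ ψ' : I → Ω, MeasurePreserving ψ volume μ ∧ MeasurePreserving ψ' volume μ ∧
      volume.real {x | c (ψ x) ≠ c' (ψ' x)} ≤
        ∑ j, dist (cumulativeMass μ c j) (cumulativeMass μ c' j) := by
  have : Nonempty Ω := nonempty_of_isProbabilityMeasure μ
  have hrearrange : ∀ {c : Ω → Fin n}, Measurable c → ∃ ψ : I → Ω, MeasurePreserving ψ volume μ ∧
      ∀ᵐ x, c (ψ x) = quantileLabel (cumulativeMass μ c) x := fun hc =>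
    exists_measurePreserving_comp_ae_eq
      (measurable_quantileLabel (monotone_cumulativeMass μ _) (cumulativeMass_zero μ _)) hc
      (map_quantileLabel_cumulativeMass μ hc)
  obtain ⟨ψ, hψ, hcψ⟩ := hrearrange hc
  obtain ⟨ψ', hψ', hcψ'⟩ := hrearrange hc'
  refine ⟨ψ, ψ', hψ, hψ', ?_⟩
  set F := cumulativeMass μ c
  set F' := cumulativeMass μ c'
  have hsub : {x | quantileLabel F x ≠ quantileLabel F' x} ⊆ ⋃ j, Set.uIcc (F j) (F' j) := by
    intro x hx
    contrapose! hx
    have hiff : ∀ j, F j ≤ x ↔ F' j ≤ x := fun j => by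
      have hj : x ∉ Set.uIcc (F j) (F' j) := fun hj => hx (Set.mem_iUnion.2 ⟨j, hj⟩)
      rw [Set.mem_uIcc] at hj
      push Not at hj
      exact ⟨fun h => (hj.1 h).le, fun h => (hj.2 h).le⟩
    simp [quantileLabel, hiff]
  calc volume.real {x | c (ψ x) ≠ c' (ψ' x)}
      = volume.real {x | quantileLabel F x ≠ quantileLabel F' x} :=
        measureReal_congr <| by
          filter_upwards [hcψ, hcψ'] with x hx hx'
          exact propext (not_congr (by rw [hx, hx']))
    _ ≤ volume.real (⋃ j, Set.uIcc (F j) (F' j)) := measureReal_mono hsub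
    _ ≤ ∑ j, volume.real (Set.uIcc (F j) (F' j)) := measureReal_iUnion_fintype_le _
    _ = ∑ j, dist (F j) (F' j) := Finset.sum_congr rfl fun j _ => by
        rw [measureReal_def, unitInterval.volume_uIcc, edist_dist,
          ENNReal.toReal_ofReal dist_nonneg, dist_comm]

end Quantile

namespace DecoratedGraphon

section CutDistance

variable {k : ℕ} (U V W : DecoratedGraphon k) {φ ψ : I → I}

lemma prob_nonneg (i : Fin k) (z : I × I) : 0 ≤ W.prob i z := measureReal_nonneg

lemma abs_prob_le_one (i : Fin k) (z : I × I) : |W.prob i z| ≤ 1 :=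
  (abs_of_nonneg (W.prob_nonneg i z)).trans_le measureReal_le_one

lemma sum_prob (z : I × I) : ∑ i, W.prob i z = 1 := by
  simp only [prob, sum_measureReal_singleton, Finset.coe_univ, probReal_univ]

lemma prob_swap (i : Fin k) (z : I × I) : W.prob i z.swap = W.prob i z :=
  congrArg (fun p : ProbabilityMeasure (Fin k) => (p : Measure (Fin k)).real {i}) (W.symm z.2 z.1)

lemma measurable_prob (i : Fin k) : Measurable (W.prob i) :=
  ((Measure.measurable_coe (measurableSet_singleton i)).comp W.measurable_toFun).ennreal_toReal

lemma memLp_prob (p : ENNReal) (i : Fin k) : MemLp (W.prob i) p :=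
  MemLp.of_bound (W.measurable_prob i).aestronglyMeasurable 1 (ae_of_all _ (W.abs_prob_le_one i))

lemma integrable_prob (i : Fin k) : Integrable (W.prob i) :=
  memLp_one_iff_integrable.1 (W.memLp_prob 1 i)

lemma integral_sq_prob_le_one (i : Fin k) : ∫ z, W.prob i z ^ 2 ≤ 1 := by
  calc ∫ z, W.prob i z ^ 2 ≤ ∫ _ : I × I, (1 : ℝ) :=
        integral_mono_of_nonneg (ae_of_all _ fun _ => sq_nonneg _) (integrable_const _)
          (ae_of_all _ fun z => (sq_le_one_iff_abs_le_one _).2 (W.abs_prob_le_one i z))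
    _ = 1 := by simp

/-- The vector `(W_1, …, W_k)` of colour probabilities. Its values carry the `ℓ¹` norm, so that
`cutDist` becomes a cut norm. -/
noncomputable def density (z : I × I) : PiLp 1 fun _ : Fin k => ℝ :=
  WithLp.toLp 1 fun i => W.prob i z

lemma integrable_density : Integrable W.density := .of_eval_piLp W.integrable_prob

lemma cutDist_eq_cutNorm : cutDist U W = cutNorm volume volume (U.density - W.density) := by
  refine congrArg iSup (funext fun p => ?_)
  rw [PiLp.norm_eq_of_L1]
  refine Finset.sum_congr rfl fun i _ => ?_
  have hint : ∀ j, Integrable (fun z => (U.density - W.density) z j)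
      (volume.restrict ((p.1 : Set I) ×ˢ (p.2 : Set I))) := fun j =>
    ((U.integrable_prob j).sub (W.integrable_prob j)).integrableOn
  exact congrArg abs (eval_integral_piLp hint i).symm

lemma cutDist_nonneg : 0 ≤ cutDist U W := cutDist_eq_cutNorm U W ▸ cutNorm_nonneg

lemma cutDist_self : cutDist U U = 0 := by simp [cutDist]

lemma cutDist_comm : cutDist U W = cutDist W U := by
  rw [cutDist_eq_cutNorm, cutNorm_sub_comm, cutDist_eq_cutNorm]

lemma cutDist_triangle : cutDist U W ≤ cutDist U V + cutDist V W := by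
  simp only [cutDist_eq_cutNorm]
  exact cutNorm_sub_le_add U.integrable_density V.integrable_density W.integrable_density

lemma cutDist_pullback_le (hφ : MeasurePreserving φ volume volume) :
    cutDist (U.pullback φ hφ) (W.pullback φ hφ) ≤ cutDist U W := by
  simp only [cutDist_eq_cutNorm]
  exact cutNorm_comp_prodMap_le hφ hφ (U.integrable_density.sub W.integrable_density)

lemma cutDelta_le_cutDist_pullback (hφ : MeasurePreserving φ volume volume) :
    cutDelta U W ≤ cutDist U (W.pullback φ hφ) :=
  ciInf_le (f := fun φ : {φ : I → I // MeasurePreserving φ volume volume} =>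
      cutDist U (W.pullback φ.1 φ.2))
    ⟨0, Set.forall_mem_range.2 fun _ => cutDist_nonneg _ _⟩ ⟨φ, hφ⟩

lemma cutDelta_le_cutDist : cutDelta U W ≤ cutDist U W :=
  cutDelta_le_cutDist_pullback U W (MeasurePreserving.id volume)

lemma cutDelta_nonneg : 0 ≤ cutDelta U W := Real.iInf_nonneg fun _ => cutDist_nonneg _ _

lemma cutDelta_self : cutDelta U U = 0 :=
  le_antisymm ((cutDelta_le_cutDist U U).trans_eq (cutDist_self U)) (cutDelta_nonneg U U)

variable {U V W} in
lemma exists_cutDist_pullback_lt {a : ℝ} (h : cutDelta U W < a) :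
    ∃ (φ : I → I) (hφ : MeasurePreserving φ volume volume), cutDist U (W.pullback φ hφ) < a :=
  have : Nonempty {φ : I → I // MeasurePreserving φ volume volume} :=
    ⟨⟨id, MeasurePreserving.id volume⟩⟩
  let ⟨φ, hφ⟩ := exists_lt_of_ciInf_lt h
  ⟨φ.1, φ.2, hφ⟩

lemma cutDelta_triangle : cutDelta U W ≤ cutDelta U V + cutDelta V W := by
  refine le_of_forall_pos_le_add fun ε hε => ?_
  obtain ⟨φ, hφ, hUV⟩ :=
    exists_cutDist_pullback_lt (lt_add_of_pos_right (cutDelta U V) (half_pos hε))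
  obtain ⟨ψ, hψ, hVW⟩ :=
    exists_cutDist_pullback_lt (lt_add_of_pos_right (cutDelta V W) (half_pos hε))
  calc cutDelta U W ≤ cutDist U ((W.pullback ψ hψ).pullback φ hφ) :=
        cutDelta_le_cutDist_pullback U W (hψ.comp hφ)
    _ ≤ cutDist U (V.pullback φ hφ) +
          cutDist (V.pullback φ hφ) ((W.pullback ψ hψ).pullback φ hφ) := cutDist_triangle _ _ _
    _ ≤ cutDist U (V.pullback φ hφ) + cutDist V (W.pullback ψ hψ) := by
        gcongr
        exact cutDist_pullback_le V (W.pullback ψ hψ) hφ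
    _ ≤ cutDelta U V + cutDelta V W + ε := by linarith

/-- A measure-preserving `ψ` with `φ ∘ ψ` close to the identity makes `(W^φ)^ψ` close to `W`. -/
lemma cutDelta_pullback (hφ : MeasurePreserving φ volume volume) :
    cutDelta W (W.pullback φ hφ) = 0 := by
  refine le_antisymm (le_of_forall_pos_le_add fun ε hε => ?_) (cutDelta_nonneg _ _)
  obtain ⟨δ, hδ, hW⟩ := exists_pos_forall_integral_norm_sub_comp_le W.integrable_density hε
  obtain ⟨ψ, hψ, hψδ⟩ := exists_measurePreserving_dist_comp_lt hφ hδ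
  have hφψ : MeasurePreserving (φ ∘ ψ) volume volume := hφ.comp hψ
  calc cutDelta W (W.pullback φ hφ)
      ≤ cutDist W ((W.pullback φ hφ).pullback ψ hψ) := cutDelta_le_cutDist_pullback _ _ hψ
    _ ≤ ∫ z, ‖W.density z - W.density (Prod.map (φ ∘ ψ) (φ ∘ ψ) z)‖ := by
        rw [cutDist_eq_cutNorm]
        exact cutNorm_le_integral_norm (μ := volume) (ν := volume)
          (W.integrable_density.sub (integrable_density _))
    _ ≤ ε := by
        refine hW (Prod.map (φ ∘ ψ) (φ ∘ ψ)) (hφψ.prod hφψ) ?_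
        filter_upwards [Measure.quasiMeasurePreserving_fst.ae hψδ,
          Measure.quasiMeasurePreserving_snd.ae hψδ] with z hz₁ hz₂
        exact max_lt hz₁ hz₂
    _ = 0 + ε := (zero_add ε).symm

lemma cutDelta_comm : cutDelta U W = cutDelta W U := by
  suffices hle : ∀ U W : DecoratedGraphon k, cutDelta U W ≤ cutDelta W U from
    le_antisymm (hle U W) (hle W U)
  intro U W
  refine le_of_forall_gt_imp_ge_of_dense fun a ha => ?_
  obtain ⟨φ, hφ, hWU⟩ := exists_cutDist_pullback_lt ha
  calc cutDelta U W ≤ cutDelta U (U.pullback φ hφ) + cutDelta (U.pullback φ hφ) W :=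
        cutDelta_triangle _ _ _
    _ = cutDelta (U.pullback φ hφ) W := by rw [cutDelta_pullback, zero_add]
    _ ≤ cutDist (U.pullback φ hφ) W := cutDelta_le_cutDist _ _
    _ = cutDist W (U.pullback φ hφ) := cutDist_comm _ _
    _ ≤ a := hWU.le

/-- The cut distance makes the graphons themselves a pseudometric space. -/
noncomputable instance : PseudoMetricSpace (DecoratedGraphon k) where
  dist := cutDelta
  dist_self := cutDelta_self
  dist_comm := cutDelta_comm
  dist_triangle := cutDelta_triangle

lemma dist_pullback (hφ : MeasurePreserving φ volume volume) : dist W (W.pullback φ hφ) = 0 :=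
  cutDelta_pullback W hφ

lemma dist_le_cutDist : dist U W ≤ cutDist U W := cutDelta_le_cutDist U W

lemma dist_le_cutDist_pullback_pullback (hφ : MeasurePreserving φ volume volume)
    (hψ : MeasurePreserving ψ volume volume) :
    dist U W ≤ cutDist (U.pullback φ hφ) (W.pullback ψ hψ) := by
  have h := dist_triangle4_right U W (U.pullback φ hφ) (W.pullback ψ hψ)
  rw [dist_pullback, dist_pullback, add_zero, zero_add] at h
  linarith [dist_le_cutDist (U.pullback φ hφ) (W.pullback ψ hψ)]

end CutDistance

section TotallyBounded

variable {k : ℕ} {U W : DecoratedGraphon k}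

lemma cutNorm_density_pullback_sub_stepKernel_le {n : ℕ} {φ : I → I}
    (hφ : MeasurePreserving φ volume volume) (A : Fin n → Fin n → PiLp 1 fun _ : Fin k => ℝ)
    {c : I → Fin n} (hc : Measurable c) :
    cutNorm volume volume ((W.pullback φ hφ).density - stepKernel A (c ∘ φ)) ≤
      cutNorm volume volume (W.density - stepKernel A c) :=
  cutNorm_comp_prodMap_le hφ hφ (W.integrable_density.sub (integrable_stepKernel A hc))

/-- Rearranging both colourings into increasing order makes them agree on most of `[0, 1]`. -/
lemma dist_le_of_cutNorm_sub_stepKernel_le {n : ℕ} [NeZero n]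
    {A : Fin n → Fin n → PiLp 1 fun _ : Fin k => ℝ} {C : ℝ} (hA : ∀ l m, ‖A l m‖ ≤ C)
    {c c' : I → Fin n} (hc : Measurable c) (hc' : Measurable c') {ε : ℝ}
    (hU : cutNorm volume volume (U.density - stepKernel A c) ≤ ε)
    (hW : cutNorm volume volume (W.density - stepKernel A c') ≤ ε) :
    dist U W ≤
      2 * ε + 4 * C * ∑ j, dist (cumulativeMass volume c j) (cumulativeMass volume c' j) := by
  obtain ⟨φ, ψ, hφ, hψ, hne⟩ := exists_measurePreserving_measureReal_ne_le (μ := volume) hc hc'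
  have hcφ : Measurable (c ∘ φ) := hc.comp hφ.measurable
  have hcψ : Measurable (c' ∘ ψ) := hc'.comp hψ.measurable
  have hC : 0 ≤ C := (norm_nonneg _).trans (hA 0 0)
  have hUφ := (cutNorm_density_pullback_sub_stepKernel_le (W := U) hφ A hc).trans hU
  have hWψ := (cutNorm_density_pullback_sub_stepKernel_le (W := W) hψ A hc').trans hW
  rw [cutNorm_sub_comm] at hWψ
  have hstep : cutNorm volume volume (stepKernel A (c ∘ φ) - stepKernel A (c' ∘ ψ)) ≤
      4 * C * ∑ j, dist (cumulativeMass volume c j) (cumulativeMass volume c' j) :=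
    (cutNorm_stepKernel_sub_le hcφ hcψ hA).trans (by gcongr; exact hne)
  calc dist U W ≤ cutDist (U.pullback φ hφ) (W.pullback ψ hψ) :=
        dist_le_cutDist_pullback_pullback U W hφ hψ
    _ = cutNorm volume volume ((U.pullback φ hφ).density - (W.pullback ψ hψ).density) :=
        cutDist_eq_cutNorm _ _
    _ ≤ cutNorm volume volume ((U.pullback φ hφ).density - stepKernel A (c ∘ φ)) +
          cutNorm volume volume (stepKernel A (c ∘ φ) - (W.pullback ψ hψ).density) :=
        cutNorm_sub_le_add (integrable_density _) (integrable_stepKernel A hcφ)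
          (integrable_density _)
    _ ≤ cutNorm volume volume ((U.pullback φ hφ).density - stepKernel A (c ∘ φ)) +
          (cutNorm volume volume (stepKernel A (c ∘ φ) - stepKernel A (c' ∘ ψ)) +
            cutNorm volume volume (stepKernel A (c' ∘ ψ) - (W.pullback ψ hψ).density)) := by
        gcongr
        exact cutNorm_sub_le_add (integrable_stepKernel A hcφ) (integrable_stepKernel A hcψ)
          (integrable_density _)
    _ ≤ _ := by linarith

/-- The code of a graphon records the coefficients of a step kernel close to it and, up to a small
error, the cumulative masses of the steps. -/
lemma totallyBounded_univ (k : ℕ) : TotallyBounded (Set.univ : Set (DecoratedGraphon k)) := by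
  refine Metric.totallyBounded_of_finite_discretization fun ε hε => ?_
  obtain ⟨n, 𝒜, h𝒜, happrox⟩ :=
    exists_finite_forall_cutNorm_sub_stepKernel_le (Fin k) (volume : Measure I)
      (show 0 < ε / 4 by positivity)
  choose A hA𝒜 c hc hcut using fun W : DecoratedGraphon k =>
    happrox W.density (W.memLp_prob 2) W.integral_sq_prob_le_one
  obtain ⟨C, hC, hC𝒜⟩ := h𝒜.isBounded.exists_pos_norm_le
  obtain ⟨m, code, -, hcode⟩ :=
    exists_measurable_fin_dist_lt (Fin n → I) (show 0 < ε / (16 * C * (n + 1)) by positivity)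
  have := h𝒜.fintype
  refine ⟨𝒜 × Fin m, inferInstance,
    fun W => (⟨A W, hA𝒜 W⟩, code (cumulativeMass volume (c W))), fun ⟨U, _⟩ ⟨W, _⟩ hUW => ?_⟩
  obtain ⟨hAUW, hcUW⟩ := Prod.mk.inj hUW
  have hAUW : A U = A W := congrArg Subtype.val hAUW
  have : NeZero n := ⟨fun hn => by subst hn; exact (c U 0).elim0⟩
  have hAC : ∀ l m, ‖A W l m‖ ≤ C := fun l m =>
    (norm_le_pi_norm _ m).trans ((norm_le_pi_norm _ l).trans (hC𝒜 _ (hA𝒜 W)))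
  have hmass : ∑ j, dist (cumulativeMass volume (c U) j) (cumulativeMass volume (c W) j) ≤
      n * (ε / (16 * C * (n + 1))) := by
    refine (Finset.sum_le_card_nsmul _ _ _ fun j _ =>
      (dist_le_pi_dist _ _ j).trans (hcode _ _ hcUW).le).trans_eq ?_
    rw [Finset.card_univ, Fintype.card_fin, nsmul_eq_mul]
  calc dist U W ≤ 2 * (ε / 4) + 4 * C *
        ∑ j, dist (cumulativeMass volume (c U) j) (cumulativeMass volume (c W) j) :=
        dist_le_of_cutNorm_sub_stepKernel_le hAC (hc U) (hc W) (hAUW ▸ hcut U) (hcut W)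
    _ ≤ 2 * (ε / 4) + 4 * C * (n * (ε / (16 * C * (n + 1)))) := by gcongr
    _ = ε / 2 + ε / 4 * (n / (n + 1)) := by field_simp; ring
    _ ≤ ε / 2 + ε / 4 * 1 := by gcongr; exact (div_le_one (by positivity)).2 (by linarith)
    _ < ε := by linarith

end TotallyBounded

end DecoratedGraphon

section WeakCompactness

variable {ι : Type*} (u : Ultrafilter ι) {C : ℝ}

lemma exists_tendsto_inner_of_norm_le {H : Type*} [NormedAddCommGroup H] [InnerProductSpace ℝ H]
    [CompleteSpace H] {x : ι → H} (hx : ∀ n, ‖x n‖ ≤ C) :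
    ∃ y : H, ∀ z : H, Tendsto (fun n => ⟪x n, z⟫) u (𝓝 ⟪y, z⟫) := by
  let f : ι → WeakDual ℝ H := fun n => StrongDual.toWeakDual (InnerProductSpace.toDual ℝ H (x n))
  have hf : ∀ n, f n ∈ WeakDual.toStrongDual ⁻¹' Metric.closedBall 0 C := fun n => by
    simpa [f] using hx n
  obtain ⟨g, -, hg⟩ := (WeakDual.isCompact_closedBall (𝕜 := ℝ) (E := H) 0 C).ultrafilter_le_nhds
    (u.map f) (tendsto_principal.2 (Eventually.of_forall hf))
  refine ⟨(InnerProductSpace.toDual ℝ H).symm (WeakDual.toStrongDual g), fun z => ?_⟩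
  rw [InnerProductSpace.toDual_symm_apply]
  exact ((WeakDual.eval_continuous z).tendsto g).comp hg

lemma exists_tendsto_setIntegral_of_abs_le {α : Type*} [MeasurableSpace α] {μ : Measure α}
    [IsFiniteMeasure μ] {f : ι → α → ℝ} (hf : ∀ n, AEStronglyMeasurable (f n) μ)
    (hC : ∀ n, ∀ᵐ x ∂μ, |f n x| ≤ C) :
    ∃ g : α → ℝ, Measurable g ∧ Integrable g μ ∧ ∀ A, MeasurableSet A →
      Tendsto (fun n => ∫ x in A, f n x ∂μ) u (𝓝 (∫ x in A, g x ∂μ)) := by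
  have hmem : ∀ n, MemLp (f n) 2 μ := fun n => MemLp.of_bound (hf n) C (hC n)
  obtain ⟨y, hy⟩ := exists_tendsto_inner_of_norm_le u (x := fun n => (hmem n).toLp)
    fun n => Lp.norm_le_of_ae_bound (abs_nonneg C) (by
      filter_upwards [(hmem n).coeFn_toLp, hC n] with x hx hxC
      rw [hx]
      exact hxC.trans (le_abs_self C))
  refine ⟨y, (Lp.stronglyMeasurable y).measurable, (Lp.memLp y).integrable one_le_two,
    fun A hA => ?_⟩
  have hinner : ∀ w : Lp ℝ 2 μ,
      ⟪w, indicatorConstLp 2 hA (measure_ne_top μ A) (1 : ℝ)⟫ = ∫ x in A, w x ∂μ := fun w => by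
    rw [real_inner_comm, L2.inner_indicatorConstLp_one]
  have hlim := hy (indicatorConstLp 2 hA (measure_ne_top μ A) (1 : ℝ))
  simp only [hinner] at hlim
  exact hlim.congr fun n => integral_congr_ae (ae_restrict_of_ae (hmem n).coeFn_toLp)

end WeakCompactness

namespace DecoratedGraphon

variable {k : ℕ}

section Completeness

/-- The graphon with prescribed colour probabilities. -/
noncomputable def ofStdSimplex (v : I × I → Fin k → ℝ) (hv : Measurable v)
    (hmem : ∀ z, v z ∈ stdSimplex ℝ (Fin k)) (hsymm : ∀ z, v z.swap = v z) :
    DecoratedGraphon k where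
  toFun z := ⟨∑ i, ENNReal.ofReal (v z i) • Measure.dirac i, ⟨by
    simp [← ENNReal.ofReal_sum_of_nonneg fun i _ => (hmem z).1 i, (hmem z).2]⟩⟩
  measurable_toFun := by
    refine Measure.measurable_of_measurable_coe _ fun s _ => ?_
    simp only [ProbabilityMeasure.coe_mk, Measure.coe_finsetSum, Finset.sum_apply,
      Measure.smul_apply, smul_eq_mul]
    exact Finset.measurable_fun_sum _ fun i _ => (hv.eval (a := i)).ennreal_ofReal.mul_const _
  symm x y := Subtype.ext (by simp only [← hsymm (x, y), Prod.swap_prod_mk])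

lemma prob_ofStdSimplex {v : I × I → Fin k → ℝ} (hv : Measurable v)
    (hmem : ∀ z, v z ∈ stdSimplex ℝ (Fin k)) (hsymm : ∀ z, v z.swap = v z) (i : Fin k)
    (z : I × I) : (ofStdSimplex v hv hmem hsymm).prob i z = v z i := by
  simp [prob, ofStdSimplex, measureReal_def, Set.indicator_apply, (hmem z).1]

lemma exists_forall_prob_ae_eq {v : I × I → Fin k → ℝ} (hv : AEMeasurable v)
    (hmem : ∀ᵐ z, v z ∈ stdSimplex ℝ (Fin k)) (hsymm : ∀ᵐ z, v z.swap = v z) :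
    ∃ V : DecoratedGraphon k, ∀ᵐ z, ∀ i, V.prob i z = v z i := by
  obtain ⟨w, hw, hwmem, hvw⟩ := hv.exists_ae_eq_range_subset hmem (hmem.exists.imp' v fun _ h => h)
  have hwmem : ∀ z, w z ∈ stdSimplex ℝ (Fin k) := fun z => hwmem ⟨z, rfl⟩
  refine ⟨ofStdSimplex (fun z => midpoint ℝ (w z) (w z.swap)) ?_
    (fun z => (convex_stdSimplex ℝ _).midpoint_mem (hwmem z) (hwmem z.swap))
    (fun z => midpoint_comm _ _), ?_⟩
  · simp only [midpoint_eq_smul_add]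
    exact (hw.add (hw.comp measurable_swap)).const_smul (⅟2 : ℝ)
  · have hvw_swap : ∀ᵐ z : I × I, v z.swap = w z.swap :=
      (Measure.measurePreserving_swap (μ := volume) (ν := volume)).quasiMeasurePreserving.ae hvw
    filter_upwards [hvw, hvw_swap, hsymm] with z hz hz_swap hz_symm i
    rw [prob_ofStdSimplex, ← hz, ← hz_swap, hz_symm, midpoint_self]

section WeakLimit

variable {ι : Type*} {u : Filter ι} [u.NeBot] {W : ι → DecoratedGraphon k}
  {g : Fin k → I × I → ℝ}

lemma ae_mem_stdSimplex_of_tendsto_setIntegral_prob (hg : ∀ i, Integrable (g i))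
    (hlim : ∀ i A, MeasurableSet A →
      Tendsto (fun n => ∫ z in A, (W n).prob i z) u (𝓝 (∫ z in A, g i z))) :
    ∀ᵐ z, (fun i => g i z) ∈ stdSimplex ℝ (Fin k) := by
  have hnonneg : ∀ i, 0 ≤ᵐ[volume] g i := fun i =>
    ae_nonneg_of_forall_setIntegral_nonneg (hg i) fun A hA _ =>
      ge_of_tendsto' (hlim i A hA) fun n => integral_nonneg fun z => (W n).prob_nonneg i z
  have hsum : (fun z => ∑ i, g i z) =ᵐ[volume] fun _ => 1 := by
    refine Integrable.ae_eq_of_forall_setIntegral_eq _ _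
      (integrable_finsetSum _ fun i _ => hg i) (integrable_const 1) fun A hA _ => ?_
    rw [integral_finsetSum _ fun i _ => (hg i).integrableOn]
    refine tendsto_nhds_unique (tendsto_finsetSum _ fun i _ => hlim i A hA) ?_
    refine tendsto_const_nhds.congr fun n => ?_
    rw [← integral_finsetSum _ fun i _ => ((W n).integrable_prob i).integrableOn]
    simp only [sum_prob]
  filter_upwards [ae_all_iff.2 hnonneg, hsum] with z hz hz_sum using ⟨hz, hz_sum⟩

lemma ae_swap_eq_of_tendsto_setIntegral_prob (hg : ∀ i, Integrable (g i))
    (hlim : ∀ i A, MeasurableSet A →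
      Tendsto (fun n => ∫ z in A, (W n).prob i z) u (𝓝 (∫ z in A, g i z))) (i : Fin k) :
    ∀ᵐ z, g i z.swap = g i z := by
  have hswap : ∀ (f : I × I → ℝ) (A : Set (I × I)),
      ∫ z in Prod.swap ⁻¹' A, f z.swap = ∫ z in A, f z :=
    (Measure.measurePreserving_swap (μ := volume) (ν := volume)).setIntegral_preimage_emb
      MeasurableEquiv.prodComm.measurableEmbedding
  refine Integrable.ae_eq_of_forall_setIntegral_eq _ _ (hg i).swap (hg i) fun A hA _ => ?_
  refine tendsto_nhds_unique ?_ (hlim i A hA)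
  rw [← hswap (fun z => g i z.swap) A]
  refine (hlim i _ (measurable_swap hA)).congr fun n => ?_
  simp only [← hswap _ A, prob_swap]

end WeakLimit

lemma exists_tendsto_setIntegral_prob {ι : Type*} (u : Ultrafilter ι)
    (W : ι → DecoratedGraphon k) :
    ∃ V : DecoratedGraphon k, ∀ i A, MeasurableSet A →
      Tendsto (fun n => ∫ z in A, (W n).prob i z) u (𝓝 (∫ z in A, V.prob i z)) := by
  choose g hgm hg hlim using fun i => exists_tendsto_setIntegral_of_abs_le u
    (fun n => ((W n).measurable_prob i).aestronglyMeasurable (μ := volume))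
    (fun n => ae_of_all _ ((W n).abs_prob_le_one i))
  obtain ⟨V, hV⟩ := exists_forall_prob_ae_eq (measurable_pi_lambda _ hgm).aemeasurable
    (ae_mem_stdSimplex_of_tendsto_setIntegral_prob hg hlim)
    ((ae_all_iff.2 (ae_swap_eq_of_tendsto_setIntegral_prob hg hlim)).mono fun z hz => funext hz)
  refine ⟨V, fun i A hA => ?_⟩
  rw [integral_congr_ae (ae_restrict_of_ae (hV.mono fun z hz => hz i))]
  exact hlim i A hA

lemma integral_density_eq (W : DecoratedGraphon k) (A : Set (I × I)) :
    ∫ z in A, W.density z = WithLp.toLp 1 fun i => ∫ z in A, W.prob i z := by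
  ext i
  have hint : ∀ j, Integrable (fun z => W.density z j) (volume.restrict A) := fun j =>
    (W.integrable_prob j).integrableOn
  exact eval_integral_piLp hint i

lemma exists_cutDist_le_of_cauchy {W : ℕ → DecoratedGraphon k} {b : ℕ → ℝ}
    (h : ∀ n m, n ≤ m → cutDist (W n) (W m) ≤ b n) :
    ∃ V : DecoratedGraphon k, ∀ n, cutDist (W n) V ≤ b n := by
  obtain ⟨V, hV⟩ := exists_tendsto_setIntegral_prob (hyperfilter ℕ) W
  simp only [cutDist_eq_cutNorm] at h ⊢
  refine ⟨V, fun n => cutNorm_sub_le_of_tendsto (u := (hyperfilter ℕ : Filter ℕ))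
    (W n).integrable_density
    (fun m => (W m).integrable_density) V.integrable_density (fun S T hS hT => ?_)
    (Nat.hyperfilter_le_atTop ((eventually_ge_atTop n).mono (h n)))⟩
  simp only [← Measure.volume_eq_prod, integral_density_eq]
  exact ((PiLp.continuous_toLp 1 _).tendsto _).comp
    (tendsto_pi_nhds.2 fun i => hV i _ (hS.prod hT))

lemma cutDist_le_of_le_geometric_two {X : ℕ → DecoratedGraphon k}
    (hX : ∀ n, cutDist (X n) (X (n + 1)) ≤ (1 / 2) ^ n) {n m : ℕ} (hnm : n ≤ m) :
    cutDist (X n) (X m) ≤ 2 * (1 / 2) ^ n := by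
  suffices cutDist (X n) (X m) ≤ 2 * (1 / 2) ^ n - 2 * (1 / 2) ^ m from
    this.trans (sub_le_self _ (by positivity))
  induction m, hnm using Nat.le_induction with
  | base => rw [cutDist_self, sub_self]
  | succ m _ ih =>
    have htri := cutDist_triangle (X n) (X m) (X (m + 1))
    have hm := hX m
    rw [pow_succ]
    linarith

/-- Each `W (n + 1)` is rearranged, in turn, to be close to the rearranged `W n`. -/
lemma exists_tendsto_of_dist_lt_geometric_two {W : ℕ → DecoratedGraphon k}
    (h : ∀ n, dist (W n) (W (n + 1)) < (1 / 2) ^ n) : ∃ V, Tendsto W atTop (𝓝 V) := by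
  choose φ hφ hlt using fun n => exists_cutDist_pullback_lt (h n)
  let Φ : ℕ → {φ : I → I // MeasurePreserving φ volume volume} :=
    Nat.rec ⟨id, MeasurePreserving.id volume⟩ fun n θ => ⟨φ n ∘ θ.1, (hφ n).comp θ.2⟩
  let X : ℕ → DecoratedGraphon k := fun n => (W n).pullback (Φ n).1 (Φ n).2
  have hX : ∀ n, cutDist (X n) (X (n + 1)) ≤ (1 / 2) ^ n := fun n =>
    (cutDist_pullback_le (W n) ((W (n + 1)).pullback (φ n) (hφ n)) (Φ n).2).trans (hlt n).le
  obtain ⟨V, hV⟩ := exists_cutDist_le_of_cauchy fun n m => cutDist_le_of_le_geometric_two hX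
  have hWV : ∀ n, dist (W n) V ≤ 2 * (1 / 2) ^ n := fun n =>
    calc dist (W n) V ≤ dist (W n) (X n) + dist (X n) V := dist_triangle _ _ _
      _ = dist (X n) V := by rw [dist_pullback, zero_add]
      _ ≤ 2 * (1 / 2) ^ n := (dist_le_cutDist _ _).trans (hV n)
  have hgeom : Tendsto (fun n => 2 * (1 / 2 : ℝ) ^ n) atTop (𝓝 0) := by
    simpa using (tendsto_pow_atTop_nhds_zero_of_lt_one (r := (1 / 2 : ℝ)) (by norm_num)
      (by norm_num)).const_mul 2
  exact ⟨V, tendsto_iff_dist_tendsto_zero.2 (squeeze_zero (fun _ => dist_nonneg) hWV hgeom)⟩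

instance : CompleteSpace (DecoratedGraphon k) :=
  Metric.complete_of_convergent_controlled_sequences (fun n => (1 / 2) ^ n)
    (fun n => by positivity) fun W hW =>
      exists_tendsto_of_dist_lt_geometric_two fun n => hW n n (n + 1) le_rfl n.le_succ

end Completeness

instance : CompactSpace (DecoratedGraphon k) where
  isCompact_univ :=
    isCompact_iff_totallyBounded_isComplete.2 ⟨totallyBounded_univ k, isComplete_univ⟩

lemma cutEquiv_eq_inseparable : CutEquiv = Inseparable (X := DecoratedGraphon k) := by
  ext U W
  rw [Metric.inseparable_iff]
  rfl

end DecoratedGraphon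

/-- Being at cut distance zero is an equivalence relation on `[k]`-graphons, the cut distance
descends to a metric on the quotient, and the quotient is compact in that metric. -/
theorem mainTheorem9 (k : ℕ) :
    ∃ (h : Equivalence (DecoratedGraphon.CutEquiv (k := k)))
      (m : MetricSpace (Quotient (Setoid.mk DecoratedGraphon.CutEquiv h))),
      (∀ U W : DecoratedGraphon k,
        m.dist (Quotient.mk _ U) (Quotient.mk _ W) = DecoratedGraphon.cutDelta U W) ∧
      @CompactSpace (Quotient (Setoid.mk DecoratedGraphon.CutEquiv h))
        m.toUniformSpace.toTopologicalSpace := by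
  have h : Equivalence (DecoratedGraphon.CutEquiv (k := k)) :=
    DecoratedGraphon.cutEquiv_eq_inseparable ▸ (inseparableSetoid _).iseqv
  have hsetoid : Setoid.mk DecoratedGraphon.CutEquiv h = inseparableSetoid (DecoratedGraphon k) :=
    Setoid.ext fun U W => iff_of_eq (congrFun₂ DecoratedGraphon.cutEquiv_eq_inseparable U W)
  refine ⟨h, ?_⟩
  rw [hsetoid]
  exact ⟨(inferInstance : MetricSpace (SeparationQuotient (DecoratedGraphon k))), fun _ _ => rfl,
    Quotient.compactSpace⟩
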